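/- Let $n,m\ge 0$ and let $A\in\mathbb R^{n\times n}$, $B\in\mathbb R^{n\times m}$, $Q\in\mathbb R^{n\times n}$, $S\in\mathbb R^{m\times n}$, $R\in\mathbb R^{m\times m}$, $P^{\mathrm f}\in\mathbb R^{n\times n}$. Put $$H=\begin{pmatrix}Q&S^\top\\ S&R\end{pmatrix},\qquad \ell(x,u)=\begin{pmatrix}x\\u\end{pmatrix}^{\!\top}H\begin{pmatrix}x\\u\end{pmatrix},$$ and consider the infinite-horizon problem $$V(x_0)=\min_{u_0,u_1,\dots}\ \lim_{N\to\infty}\Big(\sum_{k=0}^{N-1}\ell(x_k,u_k)+x_N^\top P^{\mathrm f}x_N\Big)\quad\text{s.t. } x_{k+1}=Ax_k+Bu_k, \tag{1}$$ with limits taken in $[-\infty,+\infty]$. A symmetric matrix $P$ solves the discrete algebraic Riccati equation (DARE) if $R+B^\top PB$ is invertible and $$P=Q+A^\top PA-(S^\top+A^\top PB)K,\qquad K=(R+B^\top PB)^{-1}(S+B^\top PA);$$ it is a stabilizing solution if moreover all eigenvalues $\mu\in\mathbb C$ of $A-BK$ satisfy $|\mu|<1$. The pair $(A,B)$ is stabilizable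 if there is a matrix $\hat K\in\mathbb R^{m\times n}$ such that all eigenvalues of $A-B\hat K$ have modulus less than $1$. Quadratic strict $(x,u)$-pre-dissipativity holds if there are $\Lambda\in\mathbb R^{n\times n}$ and $\epsilon>0$ such that, for all $x\in\mathbb R^n$ and $u\in\mathbb R^m$, $$\begin{pmatrix}x\\u\end{pmatrix}^{\!\top}\begin{pmatrix}Q+\Lambda-A^\top\Lambda A& S^\top-A^\top\Lambda B\\ S-B^\top\Lambda A& R-B^\top\Lambda B\end{pmatrix}\begin{pmatrix}x\\u\end{pmatrix}\ \ge\ \epsilon\,(\|x\|^2+\|u\|^2).$$ Theorem. Let $H$ be symmetric positive semidefinite, let $P^{\mathrm f}$ be symmetric positive definite, let $(A,B)$ be stabilizable, and let quadratic strict $(x,u)$-pre-dissipativity hold. Then the DARE has a stabilizing solution. The limit in (1) exists in $[-\infty,+\infty]$ for every $x_0$ and every input sequence. If $P$ is a stabilizing solution of the DARE, with associated $K$, then the value function and the optimal feedback of (1) are those given by $P$: for every $x_0\in\mathbb R^n$ the minimum in (1) is attained and $V(x_0)=x_0^\top Px_0$, and an input sequence $(u_k)$ is optimal for $x_0$ if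 and only if $u_k=-Kx_k$ for all $k\ge0$, where $(x_k)$ is the corresponding state trajectory. -/

import Mathlib

open Filter Topology Matrix

noncomputable section

/-- The data of a linear-quadratic problem with `n` states and `m` inputs: the system
`x⁺ = A x + B u`, the blocks of the stage cost matrix `H = [Q, Sᵀ; S, R]`, and the terminal
cost matrix `Pf`. -/
structure LQProblem (n m : ℕ) where
  A : Matrix (Fin n) (Fin n) ℝ
  B : Matrix (Fin n) (Fin m) ℝ
  Q : Matrix (Fin n) (Fin n) ℝ
  S : Matrix (Fin m) (Fin n) ℝ
  R : Matrix (Fin m) (Fin m) ℝ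
  Pf : Matrix (Fin n) (Fin n) ℝ

/-- A real square matrix is Schur stable if all its complex eigenvalues satisfy `|μ| < 1`. -/
def IsSchurStable {n : ℕ} (M : Matrix (Fin n) (Fin n) ℝ) : Prop :=
  ∀ μ : ℂ, Module.End.HasEigenvalue (Matrix.toLin' (M.map (algebraMap ℝ ℂ))) μ → ‖μ‖ < 1

/-- `(A, B)` is stabilizable: some linear state feedback `u = -K x` makes `A - B K` Schur stable. -/
def IsStabilizable {n m : ℕ} (A : Matrix (Fin n) (Fin n) ℝ) (B : Matrix (Fin n) (Fin m) ℝ) :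
    Prop :=
  ∃ K : Matrix (Fin m) (Fin n) ℝ, IsSchurStable (A - B * K)

namespace LQProblem

variable {n m : ℕ} (p : LQProblem n m)

/-- The stage cost matrix `H = [Q, Sᵀ; S, R]`. -/
def H : Matrix (Fin n ⊕ Fin m) (Fin n ⊕ Fin m) ℝ :=
  Matrix.fromBlocks p.Q p.Sᵀ p.S p.R

/-- The stage cost `ℓ(x, u) = [x; u]ᵀ H [x; u]`. -/
def stageCost (x : Fin n → ℝ) (u : Fin m → ℝ) : ℝ :=
  Sum.elim x u ⬝ᵥ (p.H *ᵥ Sum.elim x u)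

/-- The rotated stage cost matrix `H_Λ`, for the storage function `λ(x) = xᵀ Λ x`. -/
def rotatedH (L : Matrix (Fin n) (Fin n) ℝ) : Matrix (Fin n ⊕ Fin m) (Fin n ⊕ Fin m) ℝ :=
  Matrix.fromBlocks
    (p.Q + L - p.Aᵀ * L * p.A) (p.Sᵀ - p.Aᵀ * L * p.B)
    (p.S - p.Bᵀ * L * p.A) (p.R - p.Bᵀ * L * p.B)

/-- Quadratic strict `(x,u)`-pre-dissipativity: for some `Λ` and some `ε > 0`,
`[x; u]ᵀ H_Λ [x; u] ≥ ε (‖x‖² + ‖u‖²)` for all `x`, `u` (Euclidean norms). -/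
def QuadStrictPreDissipative : Prop :=
  ∃ L : Matrix (Fin n) (Fin n) ℝ, ∃ ε : ℝ, 0 < ε ∧
    ∀ (x : Fin n → ℝ) (u : Fin m → ℝ),
      ε * (x ⬝ᵥ x + u ⬝ᵥ u) ≤ Sum.elim x u ⬝ᵥ (p.rotatedH L *ᵥ Sum.elim x u)

/-- The state trajectory `x₀, x₁, …` with `x_{k+1} = A x_k + B u_k`. -/
def state (x₀ : Fin n → ℝ) (u : ℕ → Fin m → ℝ) : ℕ → Fin n → ℝ
  | 0 => x₀
  | k + 1 => p.A *ᵥ state x₀ u k + p.B *ᵥ u k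

/-- The cost over the horizon `N`: `∑_{k<N} ℓ(x_k, u_k) + x_Nᵀ Pf x_N`. -/
def finiteCost (x₀ : Fin n → ℝ) (u : ℕ → Fin m → ℝ) (N : ℕ) : ℝ :=
  (∑ k ∈ Finset.range N, p.stageCost (p.state x₀ u k) (u k)) +
    p.state x₀ u N ⬝ᵥ (p.Pf *ᵥ p.state x₀ u N)

/-- `J` is the infinite-horizon cost of the input sequence `u` from `x₀`: the finite-horizon
costs converge to `J` in `[-∞, +∞]` as `N → ∞`. -/
def HasInfiniteCost (x₀ : Fin n → ℝ) (u : ℕ → Fin m → ℝ) (J : EReal) : Prop :=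
  Tendsto (fun N => ((p.finiteCost x₀ u N : ℝ) : EReal)) atTop (𝓝 J)

/-- The set of costs over which the infinite-horizon problem minimizes. -/
def infiniteCosts (x₀ : Fin n → ℝ) : Set EReal :=
  {J | ∃ u : ℕ → Fin m → ℝ, p.HasInfiniteCost x₀ u J}

/-- `V` is the optimal value function of the infinite-horizon problem (the minimum is attained
for every initial state). -/
def IsValueFunction (V : (Fin n → ℝ) → ℝ) : Prop :=
  ∀ x₀, IsLeast (p.infiniteCosts x₀) (V x₀ : EReal)

/-- `u` is an optimal input sequence of the infinite-horizon problem from `x₀`. -/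
def IsOptimalInput (x₀ : Fin n → ℝ) (u : ℕ → Fin m → ℝ) : Prop :=
  ∃ J, p.HasInfiniteCost x₀ u J ∧ IsLeast (p.infiniteCosts x₀) J

/-- `F` is the optimal feedback law of the infinite-horizon problem: from every initial state the
optimal input sequences are exactly those generated by `u_k = F(x_k)` (there is precisely one
such sequence, namely the one obtained by closing the loop with `F`). -/
def IsOptimalFeedback (F : (Fin n → ℝ) → Fin m → ℝ) : Prop :=
  ∀ x₀ u, p.IsOptimalInput x₀ u ↔ ∀ k, u k = F (p.state x₀ u k)

/-- The gain `K = (R + Bᵀ P B)⁻¹ (S + Bᵀ P A)` associated with `P`. -/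
def gain (P : Matrix (Fin n) (Fin n) ℝ) : Matrix (Fin m) (Fin n) ℝ :=
  (p.R + p.Bᵀ * P * p.B)⁻¹ * (p.S + p.Bᵀ * P * p.A)

/-- `P` is a symmetric solution of the discrete algebraic Riccati equation
`P = Q + Aᵀ P A - (Sᵀ + Aᵀ P B) K`, where `K` is the gain of `P`; the inverse in `K` exists. -/
structure IsDARESolution (P : Matrix (Fin n) (Fin n) ℝ) : Prop where
  symm : P.IsSymm
  isUnit : IsUnit (p.R + p.Bᵀ * P * p.B)
  eqn : P = p.Q + p.Aᵀ * P * p.A - (p.Sᵀ + p.Aᵀ * P * p.B) * p.gain P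

/-- `P` is a stabilizing solution of the DARE: moreover `A - B K` is Schur stable. -/
structure IsStabilizingSolution (P : Matrix (Fin n) (Fin n) ℝ) : Prop where
  isSolution : p.IsDARESolution P
  schur : IsSchurStable (p.A - p.B * p.gain P)

end LQProblem

end

/-!
For `Λ` as in the dissipativity assumption, made symmetric without changing its quadratic form,
`H_{cΛ} = (1 - c) H + c H_Λ` is positive definite for `0 < c < 1` because `H ⪰ 0`,
and `Pf + cΛ ≻ 0` for small `c` because `Pf ≻ 0`. Rotating the stage cost by `L = cΛ` and adding
`L` to the terminal cost changes every finite-horizon cost by the constant `x₀ᵀ L x₀` and turns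
the solutions `P` of the DARE into `P + L`, without changing the gains. So one may
assume `H ≻ 0` and `Pf ⪰ 0`.

Then the cost of an input sequence tends to `+∞`, or is finite and forces the state to `0`.
Value iteration from `0` increases, is bounded by the cost of a stabilizing feedback, and so
converges to a positive semidefinite solution of the DARE; its closed loop has finite cost,
hence is Schur stable. Finally, for a stabilizing solution `P`, completing the square in the
Bellman equation shows that the cost of any input sequence whose state tends to `0` is
`x₀ᵀ P x₀` plus a sum of squares of the deviations `u_k + K x_k`, weighted by `R + Bᵀ P B ≻ 0`.
-/

open Asymptotics

/-- The quadratic form `x ↦ xᵀ M x` of a real square matrix, which need not be symmetric; unbundled,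
so that stage costs and terminal costs unfold to it. -/
def quadForm {ι : Type*} [Fintype ι] (M : Matrix ι ι ℝ) (x : ι → ℝ) : ℝ := x ⬝ᵥ (M *ᵥ x)

section QuadForm

variable {ι κ : Type*} [Fintype ι] [Fintype κ] {P M : Matrix ι ι ℝ}

lemma quadForm_zero_right (M : Matrix ι ι ℝ) : quadForm M 0 = 0 := by simp [quadForm]

lemma quadForm_add_left (M N : Matrix ι ι ℝ) (x : ι → ℝ) :
    quadForm (M + N) x = quadForm M x + quadForm N x := by
  simp [quadForm, add_mulVec]

lemma quadForm_smul_left (c : ℝ) (M : Matrix ι ι ℝ) (x : ι → ℝ) :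
    quadForm (c • M) x = c * quadForm M x := by
  simp [quadForm, smul_mulVec]

lemma quadForm_smul_right (M : Matrix ι ι ℝ) (c : ℝ) (x : ι → ℝ) :
    quadForm M (c • x) = c ^ 2 * quadForm M x := by
  simp [quadForm, mulVec_smul]
  ring

lemma quadForm_transpose (M : Matrix ι ι ℝ) (x : ι → ℝ) : quadForm Mᵀ x = quadForm M x :=
  dotProduct_transpose_mulVec M x x

lemma quadForm_transpose_mul_mul (M : Matrix ι ι ℝ) (T : Matrix ι κ ℝ) (x : κ → ℝ) :
    quadForm (Tᵀ * M * T) x = quadForm M (T *ᵥ x) := by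
  simp only [quadForm, ← mulVec_mulVec, dotProduct_transpose_mulVec]
  exact dotProduct_comm _ _

lemma continuous_quadForm : Continuous fun q : Matrix ι ι ℝ × (ι → ℝ) => quadForm q.1 q.2 := by
  unfold quadForm
  fun_prop

lemma tendsto_quadForm_zero {α : Type*} {l : Filter α} {x : α → ι → ℝ} (M : Matrix ι ι ℝ)
    (hx : Tendsto x l (𝓝 0)) : Tendsto (fun a => quadForm M (x a)) l (𝓝 0) := by
  simpa only [Function.comp_def, quadForm_zero_right] using
    (continuous_quadForm.tendsto (M, 0)).comp (tendsto_const_nhds.prodMk_nhds hx)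

lemma isBigO_quadForm (M : Matrix ι ι ℝ) : quadForm M =O[⊤] fun x => ‖x‖ ^ 2 := by
  have hcoord (i : ι) : (fun x : ι → ℝ => x i) =O[⊤] fun x => ‖x‖ :=
    .of_bound 1 (.of_forall fun x => by simpa using norm_le_pi_norm x i)
  simp only [sq]
  exact .fun_sum fun i _ => (hcoord i).mul (.fun_sum fun j _ => (hcoord j).const_mul_left (M i j))

lemma exists_isSymm_quadForm_eq (M : Matrix ι ι ℝ) :
    ∃ N : Matrix ι ι ℝ, N.IsSymm ∧ quadForm N = quadForm M := by
  refine ⟨(1 / 2 : ℝ) • (M + Mᵀ), (isSymm_add_transpose_self M).smul _, funext fun x => ?_⟩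
  rw [quadForm_smul_left, quadForm_add_left, quadForm_transpose]
  ring

lemma posDef_iff_isSymm_and_quadForm_pos :
    P.PosDef ↔ P.IsSymm ∧ ∀ x, x ≠ 0 → 0 < quadForm P x := by
  simp only [posDef_iff_dotProduct_mulVec, isHermitian_iff_isSymm, star_trivial, quadForm, ne_eq]

lemma posSemidef_iff_isSymm_and_quadForm_nonneg :
    P.PosSemidef ↔ P.IsSymm ∧ ∀ x, 0 ≤ quadForm P x := by
  simp only [posSemidef_iff_dotProduct_mulVec, isHermitian_iff_isSymm, star_trivial, quadForm]

lemma quadForm_nonneg (hP : P.PosSemidef) (x : ι → ℝ) : 0 ≤ quadForm P x :=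
  (posSemidef_iff_isSymm_and_quadForm_nonneg.mp hP).2 x

lemma quadForm_pos (hP : P.PosDef) {x : ι → ℝ} (hx : x ≠ 0) : 0 < quadForm P x :=
  (posDef_iff_isSymm_and_quadForm_pos.mp hP).2 x hx

lemma posDef_of_quadForm_pos_on_sphere (hP : P.IsSymm)
    (hpos : ∀ x ∈ Metric.sphere (0 : ι → ℝ) 1, 0 < quadForm P x) : P.PosDef := by
  refine posDef_iff_isSymm_and_quadForm_pos.mpr ⟨hP, fun x hx => ?_⟩
  have hnorm : 0 < ‖x‖ := norm_pos_iff.mpr hx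
  have hunit := hpos (‖x‖⁻¹ • x) (by simp [norm_smul, hnorm.ne'])
  rw [quadForm_smul_right] at hunit
  exact pos_of_mul_pos_right hunit (sq_nonneg _)

lemma eventually_posDef_add_smul {ι : Type*} [Finite ι] {P M : Matrix ι ι ℝ} (hP : P.PosDef)
    (hM : M.IsSymm) : ∀ᶠ c in 𝓝 (0 : ℝ), (P + c • M).PosDef := by
  have := Fintype.ofFinite ι
  have hcont : Continuous fun q : ℝ × (ι → ℝ) => quadForm (P + q.1 • M) q.2 :=
    continuous_quadForm.comp (by fun_prop : Continuous fun q : ℝ × (ι → ℝ) => (P + q.1 • M, q.2))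
  have hsphere : ∀ᶠ c in 𝓝 (0 : ℝ), ∀ x ∈ Metric.sphere (0 : ι → ℝ) 1,
      0 < quadForm (P + c • M) x := by
    refine (isCompact_sphere 0 1).eventually_forall_of_forall_eventually fun x hx => ?_
    refine hcont.continuousAt.eventually (lt_mem_nhds ?_)
    simpa using quadForm_pos hP (ne_zero_of_mem_unit_sphere ⟨x, hx⟩)
  filter_upwards [hsphere] with c hc
  exact posDef_of_quadForm_pos_on_sphere
    ((isHermitian_iff_isSymm.mp hP.isHermitian).add (hM.smul c)) hc

lemma exists_mul_dotProduct_self_le_quadForm (hP : P.PosDef) :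
    ∃ c : ℝ, 0 < c ∧ ∀ x, c * (x ⬝ᵥ x) ≤ quadForm P x := by
  classical
  obtain ⟨c, hdef, hc⟩ := (((eventually_posDef_add_smul hP isSymm_one.neg).filter_mono
    nhdsWithin_le_nhds).and (self_mem_nhdsWithin (s := Set.Ioi 0))).exists
  refine ⟨c, hc, fun x => ?_⟩
  have hx := quadForm_nonneg hdef.posSemidef x
  simp only [quadForm, smul_neg, add_mulVec, neg_mulVec, smul_mulVec, one_mulVec, dotProduct_add,
    dotProduct_neg, dotProduct_smul, smul_eq_mul] at hx ⊢
  linarith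

lemma tendsto_zero_of_tendsto_quadForm_zero (hP : P.PosDef) {α : Type*} {l : Filter α}
    {x : α → ι → ℝ} (h : Tendsto (fun a => quadForm P (x a)) l (𝓝 0)) : Tendsto x l (𝓝 0) := by
  obtain ⟨c, hc, hle⟩ := exists_mul_dotProduct_self_le_quadForm hP
  refine tendsto_pi_nhds.mpr fun i => ?_
  have hsq : Tendsto (fun a => x a i * x a i) l (𝓝 0) := by
    refine squeeze_zero (fun a => mul_self_nonneg _) (fun a => ?_) (by simpa using h.const_mul c⁻¹)
    rw [le_inv_mul_iff₀ hc]
    refine (mul_le_mul_of_nonneg_left ?_ hc.le).trans (hle (x a))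
    exact Finset.single_le_sum (f := fun i => x a i * x a i) (fun j _ => mul_self_nonneg _)
      (Finset.mem_univ i)
  simpa [← Real.sqrt_eq_zero', Real.sqrt_mul_self_eq_abs, tendsto_zero_iff_abs_tendsto_zero,
    Function.comp_def] using hsq.sqrt

lemma apply_eq_quadForm [DecidableEq ι] (hP : P.IsSymm) (i j : ι) :
    P i j = (quadForm P (Pi.single i 1 + Pi.single j 1) - quadForm P (Pi.single i 1)
      - quadForm P (Pi.single j 1)) / 2 := by
  simp only [quadForm, mulVec_add, add_dotProduct, dotProduct_add, single_one_dotProduct,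
    mulVec_single_one, col_apply, hP.apply i j]
  ring

lemma exists_tendsto_of_monotone_quadForm {P : ℕ → Matrix ι ι ℝ} (hP : ∀ k, (P k).IsSymm)
    (hmono : ∀ x, Monotone fun k => quadForm (P k) x)
    (hbdd : ∀ x, BddAbove (Set.range fun k => quadForm (P k) x)) :
    ∃ X : Matrix ι ι ℝ, Tendsto P atTop (𝓝 X) := by
  classical
  have hq (x) : Tendsto (fun k => quadForm (P k) x) atTop (𝓝 (⨆ k, quadForm (P k) x)) :=
    tendsto_atTop_ciSup (hmono x) (hbdd x)
  have hentry (i j : ι) := (((hq (Pi.single i 1 + Pi.single j 1)).sub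
    (hq (Pi.single i 1))).sub (hq (Pi.single j 1))).div_const 2
  simp only [← apply_eq_quadForm (hP _)] at hentry
  exact ⟨of fun i j => _, tendsto_pi_nhds.mpr fun i => tendsto_pi_nhds.mpr fun j => hentry i j⟩

lemma isClosed_setOf_posSemidef {ι : Type*} [Finite ι] :
    IsClosed {P : Matrix ι ι ℝ | P.PosSemidef} := by
  have := Fintype.ofFinite ι
  simp only [posSemidef_iff_isSymm_and_quadForm_nonneg, Set.ofPred_and, Set.ofPred_forall]
  refine (isClosed_eq (by fun_prop) continuous_id).inter (isClosed_iInter fun x => ?_)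
  exact isClosed_le continuous_const (continuous_quadForm.comp (by fun_prop : Continuous (·, x)))

end QuadForm

section SchurStable

lemma exists_pow_isBigO_of_spectralRadius_lt_one {A : Type*} [NormedRing A] [NormedAlgebra ℂ A]
    [CompleteSpace A] {a : A} (ha : spectralRadius ℂ a < 1) :
    ∃ r ∈ Set.Ico (0 : ℝ) 1, (fun k => a ^ k) =O[atTop] fun k => r ^ k := by
  obtain ⟨r, har, hr⟩ := ENNReal.lt_iff_exists_nnreal_btwn.mp ha
  refine ⟨r, ⟨r.2, by exact_mod_cast hr⟩, .of_bound 1 ?_⟩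
  filter_upwards [(spectrum.pow_nnnorm_pow_one_div_tendsto_nhds_spectralRadius a).eventually
    (gt_mem_nhds har), eventually_gt_atTop 0] with k hk hk0
  have hpow : (‖a ^ k‖₊ : ENNReal) ≤ (r : ENNReal) ^ k := by
    have h := ENNReal.rpow_le_rpow hk.le (Nat.cast_nonneg (α := ℝ) k)
    rwa [← ENNReal.rpow_mul, one_div, inv_mul_cancel₀ (by positivity), ENNReal.rpow_one,
      ENNReal.rpow_natCast] at h
  have hnorm : ‖a ^ k‖ ≤ (r : ℝ) ^ k := by exact_mod_cast hpow
  simpa using hnorm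

variable {n : ℕ} {M : Matrix (Fin n) (Fin n) ℝ}

lemma isSchurStable_of_tendsto_pow_mulVec
    (h : ∀ x : Fin n → ℝ, Tendsto (fun k => (M ^ k) *ᵥ x) atTop (𝓝 0)) : IsSchurStable M := by
  intro μ hμ
  obtain ⟨v, hv⟩ := hμ.exists_hasEigenvector
  obtain ⟨i, hi⟩ := Function.ne_iff.mp hv.2
  have hpow (k : ℕ) : (M ^ k).map (algebraMap ℝ ℂ) *ᵥ v = μ ^ k • v := by
    rw [Matrix.map_pow, ← hv.pow_apply k, ← toLin'_pow, toLin'_apply]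
  have hlim : Tendsto (fun k => M ^ k) atTop (𝓝 0) := by
    refine tendsto_pi_nhds.mpr fun i => tendsto_pi_nhds.mpr fun j => ?_
    simpa using tendsto_pi_nhds.mp (h (Pi.single j 1)) i
  have hlimC : Tendsto (fun k => μ ^ k • v) atTop (𝓝 0) := by
    have hcont : Continuous fun X : Matrix (Fin n) (Fin n) ℝ => X.map (algebraMap ℝ ℂ) *ᵥ v :=
      (continuous_id.matrix_map (continuous_algebraMap ℝ ℂ)).matrix_mulVec continuous_const
    simpa only [Function.comp_def, hpow, Matrix.map_zero _ (map_zero _), zero_mulVec] using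
      (hcont.tendsto 0).comp hlim
  refine tendsto_pow_atTop_nhds_zero_iff_norm_lt_one.mp ?_
  simpa [mul_assoc, mul_inv_cancel₀ (show v i ≠ 0 from hi)] using
    (tendsto_pi_nhds.mp hlimC i).mul_const (v i)⁻¹

attribute [local instance] Matrix.linftyOpNormedRing Matrix.linftyOpNormedAlgebra

lemma IsSchurStable.spectralRadius_lt_one (h : IsSchurStable M) :
    spectralRadius ℂ (M.map (algebraMap ℝ ℂ)) < 1 := by
  rcases isEmpty_or_nonempty (Fin n) with _ | _
  · simp [spectralRadius, spectrum.of_subsingleton]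
  · refine spectrum.spectralRadius_lt_of_forall_lt (r := 1) _ fun μ hμ => ?_
    refine h μ (Module.End.hasEigenvalue_iff_mem_spectrum.mpr ?_)
    rwa [spectrum_toLin']

lemma IsSchurStable.exists_pow_mulVec_isBigO (h : IsSchurStable M) (x : Fin n → ℝ) :
    ∃ r ∈ Set.Ico (0 : ℝ) 1, (fun k => (M ^ k) *ᵥ x) =O[atTop] fun k => r ^ k := by
  obtain ⟨r, hr, hO⟩ := exists_pow_isBigO_of_spectralRadius_lt_one h.spectralRadius_lt_one
  refine ⟨r, hr, .trans (.of_bound ‖x‖ (.of_forall fun k => ?_)) hO⟩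
  have hnorm : ‖(M.map (algebraMap ℝ ℂ)) ^ k‖ = ‖M ^ k‖ := by
    rw [← Matrix.map_pow, linfty_opNorm_def, linfty_opNorm_def]
    simp
  rw [hnorm, mul_comm]
  exact linfty_opNorm_mulVec _ _

lemma IsSchurStable.tendsto_pow_mulVec (h : IsSchurStable M) (x : Fin n → ℝ) :
    Tendsto (fun k => (M ^ k) *ᵥ x) atTop (𝓝 0) := by
  obtain ⟨r, ⟨hr0, hr1⟩, hO⟩ := h.exists_pow_mulVec_isBigO x
  exact hO.trans_tendsto (tendsto_pow_atTop_nhds_zero_of_lt_one hr0 hr1)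

end SchurStable

namespace LQProblem

variable {n m : ℕ} {p : LQProblem n m} {P P' : Matrix (Fin n) (Fin n) ℝ}

variable (p) in
/-- The weight `R + Bᵀ P B` of the input in the one-step problem with terminal cost `xᵀ P x`. -/
def inputWeight (P : Matrix (Fin n) (Fin n) ℝ) : Matrix (Fin m) (Fin m) ℝ :=
  p.R + p.Bᵀ * P * p.B

variable (p) in
/-- The matrix of the quadratic form `(x, u) ↦ ℓ(x, u) + (A x + B u)ᵀ P (A x + B u)`, which the
Bellman equation minimizes over `u`. -/
def bellmanMatrix (P : Matrix (Fin n) (Fin n) ℝ) : Matrix (Fin n ⊕ Fin m) (Fin n ⊕ Fin m) ℝ :=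
  p.H + (fromCols p.A p.B)ᵀ * P * fromCols p.A p.B

variable (p) in
/-- The Riccati operator, whose symmetric fixed points are the solutions of the DARE. -/
noncomputable def riccati (P : Matrix (Fin n) (Fin n) ℝ) : Matrix (Fin n) (Fin n) ℝ :=
  p.Q + p.Aᵀ * P * p.A - (p.Sᵀ + p.Aᵀ * P * p.B) * p.gain P

lemma IsDARESolution.riccati_eq (hP : p.IsDARESolution P) : p.riccati P = P := hP.eqn.symm

lemma isDARESolution_iff :
    p.IsDARESolution P ↔ P.IsSymm ∧ IsUnit (p.inputWeight P) ∧ p.riccati P = P :=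
  ⟨fun h => ⟨h.symm, h.isUnit, h.riccati_eq⟩, fun ⟨hP, hunit, heq⟩ => ⟨hP, hunit, heq.symm⟩⟩

section BellmanMatrix

lemma quadForm_bellmanMatrix (x : Fin n → ℝ) (u : Fin m → ℝ) :
    quadForm (p.bellmanMatrix P) (Sum.elim x u)
      = p.stageCost x u + quadForm P (p.A *ᵥ x + p.B *ᵥ u) := by
  rw [bellmanMatrix, quadForm_add_left, quadForm_transpose_mul_mul, fromCols_mulVec_sumElim]
  rfl

lemma bellmanMatrix_eq_fromBlocks (hP : P.IsSymm) :
    p.bellmanMatrix P = fromBlocks (p.Q + p.Aᵀ * P * p.A) (p.Sᵀ + p.Aᵀ * P * p.B)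
      (p.Sᵀ + p.Aᵀ * P * p.B)ᴴ (p.inputWeight P) := by
  simp only [bellmanMatrix, H, inputWeight, transpose_fromCols, fromRows_mul, mul_fromCols,
    fromCols_fromRows_eq_fromBlocks, fromBlocks_add, conjTranspose_eq_transpose_of_trivial,
    transpose_add, transpose_mul, transpose_transpose, hP.eq, Matrix.mul_assoc]

lemma gain_eq (hP : P.IsSymm) :
    p.gain P = (p.inputWeight P)⁻¹ * (p.Sᵀ + p.Aᵀ * P * p.B)ᴴ := by
  simp only [gain, inputWeight, conjTranspose_eq_transpose_of_trivial, transpose_add,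
    transpose_mul, transpose_transpose, hP.eq, Matrix.mul_assoc]

lemma riccati_eq_schurComplement (hP : P.IsSymm) :
    p.riccati P = p.Q + p.Aᵀ * P * p.A
      - (p.Sᵀ + p.Aᵀ * P * p.B) * (p.inputWeight P)⁻¹ * (p.Sᵀ + p.Aᵀ * P * p.B)ᴴ := by
  rw [riccati, gain_eq hP, Matrix.mul_assoc _ (p.inputWeight P)⁻¹]

lemma posSemidef_bellmanMatrix (hH : p.H.PosSemidef) (hP : P.PosSemidef) :
    (p.bellmanMatrix P).PosSemidef :=
  hH.add (hP.conjTranspose_mul_mul_same (fromCols p.A p.B))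

lemma posSemidef_riccati (hH : p.H.PosSemidef) (hP : P.PosSemidef)
    (hG : (p.inputWeight P).PosDef) : (p.riccati P).PosSemidef := by
  have hsymm := isHermitian_iff_isSymm.mp hP.isHermitian
  have := hG.isUnit.invertible
  rw [riccati_eq_schurComplement hsymm, ← PosDef.fromBlocks₂₂ _ _ hG,
    ← bellmanMatrix_eq_fromBlocks hsymm]
  exact posSemidef_bellmanMatrix hH hP

lemma stageCost_add_quadForm (hP : P.IsSymm) (hG : (p.inputWeight P).IsSymm)
    (hunit : IsUnit (p.inputWeight P)) (x : Fin n → ℝ) (u : Fin m → ℝ) :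
    p.stageCost x u + quadForm P (p.A *ᵥ x + p.B *ᵥ u)
      = quadForm (p.riccati P) x + quadForm (p.inputWeight P) (u + p.gain P *ᵥ x) := by
  have := hunit.invertible
  have hsquare := schur_complement_eq₂₂ (p.Q + p.Aᵀ * P * p.A) (p.Sᵀ + p.Aᵀ * P * p.B) x u
    (isHermitian_iff_isSymm.mpr hG)
  simp only [← bellmanMatrix_eq_fromBlocks hP, ← riccati_eq_schurComplement hP, ← gain_eq hP,
    star_trivial, ← dotProduct_mulVec] at hsquare
  rw [← quadForm_bellmanMatrix, add_comm u, add_comm (quadForm _ x)]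
  exact hsquare

end BellmanMatrix

section Riccati

lemma posDef_R (hH : p.H.PosDef) : p.R.PosDef := hH.submatrix Sum.inr_injective

lemma isSymm_inputWeight (hR : p.R.IsSymm) (hP : P.IsSymm) : (p.inputWeight P).IsSymm := by
  simp only [inputWeight, IsSymm, transpose_add, transpose_mul, transpose_transpose, hR.eq, hP.eq,
    Matrix.mul_assoc]

lemma posDef_inputWeight (hR : p.R.PosDef) (hP : P.PosSemidef) : (p.inputWeight P).PosDef :=
  hR.add_posSemidef (hP.conjTranspose_mul_mul_same p.B)

lemma closedLoop_mulVec (K : Matrix (Fin m) (Fin n) ℝ) (x : Fin n → ℝ) :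
    p.A *ᵥ x + p.B *ᵥ (-(K *ᵥ x)) = (p.A - p.B * K) *ᵥ x := by
  rw [sub_mulVec, mulVec_neg, mulVec_mulVec, sub_eq_add_neg]

lemma quadForm_riccati_le (hP : P.IsSymm) (hG : (p.inputWeight P).PosDef) (x : Fin n → ℝ)
    (u : Fin m → ℝ) :
    quadForm (p.riccati P) x ≤ p.stageCost x u + quadForm P (p.A *ᵥ x + p.B *ᵥ u) := by
  rw [stageCost_add_quadForm hP (isHermitian_iff_isSymm.mp hG.isHermitian) hG.isUnit]
  exact le_add_of_nonneg_right (quadForm_nonneg hG.posSemidef _)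

lemma exists_quadForm_riccati_eq (hP : P.IsSymm) (hG : (p.inputWeight P).PosDef) (x : Fin n → ℝ) :
    ∃ u, quadForm (p.riccati P) x = p.stageCost x u + quadForm P (p.A *ᵥ x + p.B *ᵥ u) := by
  refine ⟨-(p.gain P *ᵥ x), ?_⟩
  rw [stageCost_add_quadForm hP (isHermitian_iff_isSymm.mp hG.isHermitian) hG.isUnit,
    neg_add_cancel, quadForm_zero_right, add_zero]

lemma quadForm_riccati_mono (hP : P.IsSymm) (hG : (p.inputWeight P).PosDef) (hP' : P'.IsSymm)
    (hG' : (p.inputWeight P').PosDef) (hle : quadForm P ≤ quadForm P') :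
    quadForm (p.riccati P) ≤ quadForm (p.riccati P') := by
  intro x
  obtain ⟨u, hu⟩ := exists_quadForm_riccati_eq hP' hG' x
  rw [hu]
  exact (quadForm_riccati_le hP hG x u).trans (add_le_add_right (hle _) _)

lemma continuousAt_riccati (hG : (p.inputWeight P).PosDef) : ContinuousAt p.riccati P := by
  have hdet : IsUnit (p.inputWeight P).det := (isUnit_iff_isUnit_det _).mp hG.isUnit
  have hinv : ContinuousAt (fun P => (p.R + p.Bᵀ * P * p.B)⁻¹) P :=
    (continuousAt_matrix_inv _ (NormedRing.inverse_continuousAt hdet.unit)).comp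
      (f := p.inputWeight) (by unfold inputWeight; fun_prop)
  unfold riccati gain
  fun_prop

end Riccati

section State

lemma state_succ (x₀ : Fin n → ℝ) (u : ℕ → Fin m → ℝ) (k : ℕ) :
    p.state x₀ u (k + 1) = p.A *ᵥ p.state x₀ u k + p.B *ᵥ u k := rfl

lemma state_succ_eq_state_tail (x₀ : Fin n → ℝ) (u : ℕ → Fin m → ℝ) (k : ℕ) :
    p.state x₀ u (k + 1) = p.state (p.A *ᵥ x₀ + p.B *ᵥ u 0) (fun k => u (k + 1)) k := by
  induction k with
  | zero => rfl
  | succ k ih => rw [state_succ, ih, ← state_succ]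

lemma state_eq_of_feedback {K : Matrix (Fin m) (Fin n) ℝ} {x₀ : Fin n → ℝ} {u : ℕ → Fin m → ℝ}
    (hu : ∀ k, u k = -(K *ᵥ p.state x₀ u k)) (k : ℕ) :
    p.state x₀ u k = ((p.A - p.B * K) ^ k) *ᵥ x₀ := by
  induction k with
  | zero => simp [state]
  | succ k ih => rw [state_succ, hu k, closedLoop_mulVec, ih, mulVec_mulVec, ← pow_succ']

variable (p) in
lemma exists_feedback_input (K : Matrix (Fin m) (Fin n) ℝ) (x₀ : Fin n → ℝ) :
    ∃ u : ℕ → Fin m → ℝ, ∀ k, u k = -(K *ᵥ p.state x₀ u k) := by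
  refine ⟨fun k => -(K *ᵥ (((p.A - p.B * K) ^ k) *ᵥ x₀)), fun k => ?_⟩
  suffices hstate : p.state x₀ (fun k => -(K *ᵥ (((p.A - p.B * K) ^ k) *ᵥ x₀))) k
      = ((p.A - p.B * K) ^ k) *ᵥ x₀ by rw [hstate]
  induction k with
  | zero => simp [state]
  | succ k ih => rw [state_succ, ih, closedLoop_mulVec, mulVec_mulVec, ← pow_succ']

lemma exists_summable_stageCost (hstab : IsStabilizable p.A p.B) (x₀ : Fin n → ℝ) :
    ∃ u, Summable fun k => p.stageCost (p.state x₀ u k) (u k) := by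
  obtain ⟨K, hK⟩ := hstab
  obtain ⟨u, hu⟩ := exists_feedback_input p K x₀
  obtain ⟨r, ⟨hr0, hr1⟩, hO⟩ := hK.exists_pow_mulVec_isBigO x₀
  simp only [← state_eq_of_feedback hu] at hO
  let T : Matrix (Fin n ⊕ Fin m) (Fin n) ℝ := fromRows 1 (-K)
  have hcost (k : ℕ) : p.stageCost (p.state x₀ u k) (u k)
      = quadForm (Tᵀ * p.H * T) (p.state x₀ u k) := by
    rw [quadForm_transpose_mul_mul, fromRows_mulVec, one_mulVec, neg_mulVec, ← hu k]
    rfl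
  refine ⟨u, summable_of_isBigO_nat (summable_geometric_of_lt_one (sq_nonneg r)
    (pow_lt_one₀ hr0 hr1 two_ne_zero)) ?_⟩
  simp only [hcost]
  refine ((isBigO_quadForm _).comp_tendsto tendsto_top).trans ?_
  simpa only [Function.comp_def, ← pow_mul, mul_comm] using hO.norm_left.pow 2

end State

section ValueIteration

variable (p) in
/-- Value iteration started from `0`: the optimal cost from `x` over the horizon `N` without
terminal cost is `xᵀ (valueIteration N) x`. -/
noncomputable def valueIteration (N : ℕ) : Matrix (Fin n) (Fin n) ℝ := p.riccati^[N] 0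

lemma valueIteration_succ (N : ℕ) :
    p.valueIteration (N + 1) = p.riccati (p.valueIteration N) :=
  Function.iterate_succ_apply' _ _ _

lemma posSemidef_valueIteration (hH : p.H.PosSemidef) (hR : p.R.PosDef) (N : ℕ) :
    (p.valueIteration N).PosSemidef := by
  induction N with
  | zero => exact .zero
  | succ N ih =>
    rw [valueIteration_succ]
    exact posSemidef_riccati hH ih (posDef_inputWeight hR ih)

lemma isSymm_valueIteration (hH : p.H.PosSemidef) (hR : p.R.PosDef) (N : ℕ) :
    (p.valueIteration N).IsSymm :=
  isHermitian_iff_isSymm.mp (posSemidef_valueIteration hH hR N).isHermitian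

lemma posDef_inputWeight_valueIteration (hH : p.H.PosSemidef) (hR : p.R.PosDef) (N : ℕ) :
    (p.inputWeight (p.valueIteration N)).PosDef :=
  posDef_inputWeight hR (posSemidef_valueIteration hH hR N)

lemma quadForm_valueIteration_le_sum (hH : p.H.PosSemidef) (hR : p.R.PosDef) (N : ℕ)
    (x₀ : Fin n → ℝ) (u : ℕ → Fin m → ℝ) :
    quadForm (p.valueIteration N) x₀
      ≤ ∑ k ∈ Finset.range N, p.stageCost (p.state x₀ u k) (u k) := by
  induction N generalizing x₀ u with
  | zero => simp [valueIteration, quadForm]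
  | succ N ih =>
    have hbellman := quadForm_riccati_le (isSymm_valueIteration hH hR N)
      (posDef_inputWeight_valueIteration hH hR N) x₀ (u 0)
    simp only [valueIteration_succ, Finset.sum_range_succ', state_succ_eq_state_tail]
    rw [add_comm]
    exact hbellman.trans (add_le_add_right (ih _ _) _)

lemma monotone_quadForm_valueIteration (hH : p.H.PosSemidef) (hR : p.R.PosDef) :
    Monotone fun N => quadForm (p.valueIteration N) := by
  refine monotone_nat_of_le_succ fun N => ?_
  induction N with
  | zero =>
    intro x
    simpa [valueIteration, quadForm] using quadForm_nonneg (posSemidef_valueIteration hH hR 1) x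
  | succ N ih =>
    have hstep := quadForm_riccati_mono (isSymm_valueIteration hH hR N)
      (posDef_inputWeight_valueIteration hH hR N) (isSymm_valueIteration hH hR (N + 1))
      (posDef_inputWeight_valueIteration hH hR (N + 1)) ih
    simpa only [← valueIteration_succ] using hstep

lemma exists_posSemidef_isDARESolution (hH : p.H.PosSemidef) (hR : p.R.PosDef)
    (hstab : IsStabilizable p.A p.B) : ∃ P, P.PosSemidef ∧ p.IsDARESolution P := by
  have hbdd (x₀ : Fin n → ℝ) : BddAbove (Set.range fun N => quadForm (p.valueIteration N) x₀) := by
    obtain ⟨u, hu⟩ := exists_summable_stageCost hstab x₀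
    exact hu.hasSum.tendsto_sum_nat.bddAbove_range.range_mono _
      fun N => quadForm_valueIteration_le_sum hH hR N x₀ u
  obtain ⟨P, hlim⟩ := exists_tendsto_of_monotone_quadForm (isSymm_valueIteration hH hR)
    (fun x _ _ hle => monotone_quadForm_valueIteration hH hR hle x) hbdd
  have hP : P.PosSemidef := isClosed_setOf_posSemidef.mem_of_tendsto hlim
    (.of_forall (posSemidef_valueIteration hH hR))
  have hG := posDef_inputWeight hR hP
  have hlim' : Tendsto (fun N => p.valueIteration (N + 1)) atTop (𝓝 (p.riccati P)) := by
    simpa only [valueIteration_succ, Function.comp_def] using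
      (continuousAt_riccati hG).tendsto.comp hlim
  exact ⟨P, hP, isHermitian_iff_isSymm.mp hP.isHermitian, hG.isUnit,
    tendsto_nhds_unique ((tendsto_add_atTop_iff_nat 1).mpr hlim) hlim'⟩

end ValueIteration

section InfiniteHorizon

variable (p) in
/-- Every finite-horizon cost sequence diverges to `+∞`, or converges along a state trajectory that
tends to the origin. -/
def HasCostDichotomy : Prop :=
  ∀ x₀ u, Tendsto (p.finiteCost x₀ u) atTop atTop ∨
    (Tendsto (p.state x₀ u) atTop (𝓝 0) ∧ ∃ c, Tendsto (p.finiteCost x₀ u) atTop (𝓝 c))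

lemma HasCostDichotomy.exists_hasInfiniteCost (h : p.HasCostDichotomy) (x₀ : Fin n → ℝ)
    (u : ℕ → Fin m → ℝ) : ∃ J : EReal, p.HasInfiniteCost x₀ u J := by
  rcases h x₀ u with htop | ⟨-, c, hc⟩
  · exact ⟨⊤, EReal.tendsto_coe_nhds_top_iff.mpr htop⟩
  · exact ⟨c, EReal.tendsto_coe.mpr hc⟩

lemma finiteCost_eq (x₀ : Fin n → ℝ) (u : ℕ → Fin m → ℝ) (N : ℕ) :
    p.finiteCost x₀ u N = ∑ k ∈ Finset.range N, p.stageCost (p.state x₀ u k) (u k)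
      + quadForm p.Pf (p.state x₀ u N) := rfl

lemma stageCost_nonneg (hH : p.H.PosSemidef) (x : Fin n → ℝ) (u : Fin m → ℝ) :
    0 ≤ p.stageCost x u :=
  quadForm_nonneg hH (Sum.elim x u)

lemma tendsto_state_zero_of_summable (hH : p.H.PosDef) {x₀ : Fin n → ℝ} {u : ℕ → Fin m → ℝ}
    (hsum : Summable fun k => p.stageCost (p.state x₀ u k) (u k)) :
    Tendsto (p.state x₀ u) atTop (𝓝 0) := by
  have hpair : Tendsto (fun k => Sum.elim (p.state x₀ u k) (u k)) atTop (𝓝 0) :=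
    tendsto_zero_of_tendsto_quadForm_zero hH hsum.tendsto_atTop_zero
  exact tendsto_pi_nhds.mpr fun i => tendsto_pi_nhds.mp hpair (Sum.inl i)

lemma hasCostDichotomy_of_posDef (hH : p.H.PosDef) (hPf : p.Pf.PosSemidef) :
    p.HasCostDichotomy := by
  intro x₀ u
  by_cases hsum : Summable fun k => p.stageCost (p.state x₀ u k) (u k)
  · have hx := tendsto_state_zero_of_summable hH hsum
    exact .inr ⟨hx, _, hsum.hasSum.tendsto_sum_nat.add (tendsto_quadForm_zero p.Pf hx)⟩
  · have htop := (not_summable_iff_tendsto_nat_atTop_of_nonneg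
      fun k => stageCost_nonneg hH.posSemidef _ _).mp hsum
    exact .inl (tendsto_atTop_mono (fun N => le_add_of_nonneg_right (quadForm_nonneg hPf _)) htop)

lemma IsDARESolution.sum_stageCost_add_quadForm (hP : p.IsDARESolution P)
    (hG : (p.inputWeight P).IsSymm) (x₀ : Fin n → ℝ) (u : ℕ → Fin m → ℝ) (N : ℕ) :
    ∑ k ∈ Finset.range N, p.stageCost (p.state x₀ u k) (u k) + quadForm P (p.state x₀ u N)
      = quadForm P x₀ + ∑ k ∈ Finset.range N,
        quadForm (p.inputWeight P) (u k + p.gain P *ᵥ p.state x₀ u k) := by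
  induction N with
  | zero => simp [state]
  | succ N ih =>
    have hsquare := LQProblem.stageCost_add_quadForm hP.symm hG hP.isUnit (p.state x₀ u N) (u N)
    rw [← state_succ, hP.riccati_eq] at hsquare
    rw [Finset.sum_range_succ, Finset.sum_range_succ]
    linarith

lemma IsDARESolution.sum_stageCost_add_quadForm_of_feedback (hP : p.IsDARESolution P)
    (hG : (p.inputWeight P).IsSymm) {x₀ : Fin n → ℝ} {u : ℕ → Fin m → ℝ}
    (hu : ∀ k, u k = -(p.gain P *ᵥ p.state x₀ u k)) (N : ℕ) :
    ∑ k ∈ Finset.range N, p.stageCost (p.state x₀ u k) (u k) + quadForm P (p.state x₀ u N)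
      = quadForm P x₀ := by
  have hdev (k : ℕ) : u k + p.gain P *ᵥ p.state x₀ u k = 0 := eq_neg_iff_add_eq_zero.mp (hu k)
  simp only [hP.sum_stageCost_add_quadForm hG, hdev, quadForm_zero_right, Finset.sum_const_zero,
    add_zero]

lemma IsDARESolution.isStabilizingSolution (hP : p.IsDARESolution P) (hH : p.H.PosDef)
    (hPpos : P.PosSemidef) : p.IsStabilizingSolution P := by
  refine ⟨hP, isSchurStable_of_tendsto_pow_mulVec fun x₀ => ?_⟩
  obtain ⟨u, hu⟩ := exists_feedback_input p (p.gain P) x₀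
  have hG := posDef_inputWeight (posDef_R hH) hPpos
  have hsum : Summable fun k => p.stageCost (p.state x₀ u k) (u k) := by
    refine summable_of_sum_range_le (c := quadForm P x₀)
      (fun k => stageCost_nonneg hH.posSemidef _ _) fun N => ?_
    rw [← hP.sum_stageCost_add_quadForm_of_feedback
      (isHermitian_iff_isSymm.mp hG.isHermitian) hu N]
    exact le_add_of_nonneg_right (quadForm_nonneg hPpos _)
  simpa only [← state_eq_of_feedback hu] using tendsto_state_zero_of_summable hH hsum

lemma exists_isStabilizingSolution (hH : p.H.PosDef) (hstab : IsStabilizable p.A p.B) :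
    ∃ P, p.IsStabilizingSolution P := by
  obtain ⟨P, hPpos, hP⟩ := exists_posSemidef_isDARESolution hH.posSemidef (posDef_R hH) hstab
  exact ⟨P, hP.isStabilizingSolution hH hPpos⟩

namespace IsStabilizingSolution

lemma tendsto_state (hP : p.IsStabilizingSolution P) {x₀ : Fin n → ℝ} {u : ℕ → Fin m → ℝ}
    (hu : ∀ k, u k = -(p.gain P *ᵥ p.state x₀ u k)) : Tendsto (p.state x₀ u) atTop (𝓝 0) := by
  simpa only [← state_eq_of_feedback hu] using hP.schur.tendsto_pow_mulVec x₀

lemma tendsto_sum_stageCost (hP : p.IsStabilizingSolution P) (hG : (p.inputWeight P).IsSymm)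
    {x₀ : Fin n → ℝ} {u : ℕ → Fin m → ℝ} (hu : ∀ k, u k = -(p.gain P *ᵥ p.state x₀ u k)) :
    Tendsto (fun N => ∑ k ∈ Finset.range N, p.stageCost (p.state x₀ u k) (u k)) atTop
      (𝓝 (quadForm P x₀)) := by
  have hsum (N : ℕ) := eq_sub_of_add_eq
    (hP.isSolution.sum_stageCost_add_quadForm_of_feedback hG hu N)
  simpa only [hsum, sub_zero] using
    (tendsto_quadForm_zero P (hP.tendsto_state hu)).const_sub (quadForm P x₀)

lemma tendsto_finiteCost (hP : p.IsStabilizingSolution P) (hG : (p.inputWeight P).IsSymm)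
    {x₀ : Fin n → ℝ} {u : ℕ → Fin m → ℝ} (hu : ∀ k, u k = -(p.gain P *ᵥ p.state x₀ u k)) :
    Tendsto (p.finiteCost x₀ u) atTop (𝓝 (quadForm P x₀)) := by
  simpa only [← finiteCost_eq, add_zero] using
    (hP.tendsto_sum_stageCost hG hu).add (tendsto_quadForm_zero p.Pf (hP.tendsto_state hu))

lemma posSemidef (hP : p.IsStabilizingSolution P) (hH : p.H.PosSemidef) : P.PosSemidef := by
  have hR : p.R.IsSymm := isHermitian_iff_isSymm.mp (hH.submatrix Sum.inr).isHermitian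
  refine posSemidef_iff_isSymm_and_quadForm_nonneg.mpr ⟨hP.isSolution.symm, fun x₀ => ?_⟩
  obtain ⟨u, hu⟩ := exists_feedback_input p (p.gain P) x₀
  exact ge_of_tendsto'
    (hP.tendsto_sum_stageCost (isSymm_inputWeight hR hP.isSolution.symm) hu)
    fun N => Finset.sum_nonneg fun k _ => stageCost_nonneg hH _ _

lemma add_quadForm_le_of_hasInfiniteCost (hP : p.IsStabilizingSolution P)
    (hG : (p.inputWeight P).PosDef) (hdich : p.HasCostDichotomy) {x₀ : Fin n → ℝ}
    {u : ℕ → Fin m → ℝ} {J : EReal} (hJ : p.HasInfiniteCost x₀ u J) (j : ℕ) :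
    ((quadForm P x₀ + quadForm (p.inputWeight P) (u j + p.gain P *ᵥ p.state x₀ u j) : ℝ) : EReal)
      ≤ J := by
  rcases hdich x₀ u with htop | ⟨hx, c, hc⟩
  · rw [tendsto_nhds_unique hJ (EReal.tendsto_coe_nhds_top_iff.mpr htop)]
    exact le_top
  rw [tendsto_nhds_unique hJ (EReal.tendsto_coe.mpr hc), EReal.coe_le_coe_iff]
  have hlim : Tendsto (fun N => p.finiteCost x₀ u N - quadForm p.Pf (p.state x₀ u N)
      + quadForm P (p.state x₀ u N)) atTop (𝓝 c) := by
    simpa using (hc.sub (tendsto_quadForm_zero p.Pf hx)).add (tendsto_quadForm_zero P hx)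
  refine ge_of_tendsto hlim ?_
  filter_upwards [eventually_gt_atTop j] with N hN
  rw [finiteCost_eq, add_sub_cancel_right, hP.isSolution.sum_stageCost_add_quadForm
    (isHermitian_iff_isSymm.mp hG.isHermitian)]
  gcongr
  exact Finset.single_le_sum
    (f := fun k => quadForm (p.inputWeight P) (u k + p.gain P *ᵥ p.state x₀ u k))
    (fun k _ => quadForm_nonneg hG.posSemidef _) (Finset.mem_range.mpr hN)

lemma isValueFunction (hP : p.IsStabilizingSolution P) (hG : (p.inputWeight P).PosDef)
    (hdich : p.HasCostDichotomy) : p.IsValueFunction (quadForm P) := by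
  refine fun x₀ => ⟨?_, ?_⟩
  · obtain ⟨u, hu⟩ := exists_feedback_input p (p.gain P) x₀
    exact ⟨u, EReal.tendsto_coe.mpr
      (hP.tendsto_finiteCost (isHermitian_iff_isSymm.mp hG.isHermitian) hu)⟩
  · rintro J ⟨u, hJ⟩
    refine le_trans ?_ (hP.add_quadForm_le_of_hasInfiniteCost hG hdich hJ 0)
    exact EReal.coe_le_coe (le_add_of_nonneg_right (quadForm_nonneg hG.posSemidef _))

lemma isOptimalFeedback (hP : p.IsStabilizingSolution P) (hG : (p.inputWeight P).PosDef)
    (hdich : p.HasCostDichotomy) : p.IsOptimalFeedback fun x => -(p.gain P *ᵥ x) := by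
  intro x₀ u
  have hV := hP.isValueFunction hG hdich x₀
  constructor
  · rintro ⟨J, hJ, hmin⟩ k
    have hle := hP.add_quadForm_le_of_hasInfiniteCost hG hdich hJ k
    rw [hmin.unique hV, EReal.coe_le_coe_iff, add_le_iff_nonpos_right] at hle
    by_contra hne
    exact hle.not_gt (quadForm_pos hG fun hdev => hne (eq_neg_of_add_eq_zero_left hdev))
  · exact fun hu => ⟨_, EReal.tendsto_coe.mpr
      (hP.tendsto_finiteCost (isHermitian_iff_isSymm.mp hG.isHermitian) hu), hV⟩

end IsStabilizingSolution

end InfiniteHorizon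

section Rotation

variable {L : Matrix (Fin n) (Fin n) ℝ}

variable (p) in
/-- The problem with the stage cost rotated by the storage function `x ↦ xᵀ L x` and the terminal
cost shifted by it. -/
def rotate (L : Matrix (Fin n) (Fin n) ℝ) : LQProblem n m where
  A := p.A
  B := p.B
  Q := p.Q + L - p.Aᵀ * L * p.A
  S := p.S - p.Bᵀ * L * p.A
  R := p.R - p.Bᵀ * L * p.B
  Pf := p.Pf + L

lemma H_rotate (hL : L.IsSymm) : (p.rotate L).H = p.rotatedH L := by
  simp only [H, rotate, rotatedH, transpose_sub, transpose_mul, transpose_transpose, hL.eq,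
    Matrix.mul_assoc]

lemma rotatedH_eq_bellmanMatrix_add : p.rotatedH L = p.bellmanMatrix (-L) + fromBlocks L 0 0 0 := by
  simp only [bellmanMatrix, H, rotatedH, transpose_fromCols, fromRows_mul, mul_fromCols,
    fromCols_fromRows_eq_fromBlocks, Matrix.mul_neg, Matrix.neg_mul, fromBlocks_neg,
    fromBlocks_add, add_zero, sub_eq_add_neg, add_right_comm]

lemma quadForm_rotatedH (x : Fin n → ℝ) (u : Fin m → ℝ) :
    quadForm (p.rotatedH L) (Sum.elim x u)
      = p.stageCost x u + quadForm L x - quadForm L (p.A *ᵥ x + p.B *ᵥ u) := by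
  have hL : quadForm (fromBlocks L 0 0 (0 : Matrix (Fin m) (Fin m) ℝ)) (Sum.elim x u)
      = quadForm L x := by
    simp [quadForm, fromBlocks_mulVec]
  have hneg : quadForm (-L) (p.A *ᵥ x + p.B *ᵥ u) = -quadForm L (p.A *ᵥ x + p.B *ᵥ u) := by
    simp [quadForm, neg_mulVec]
  rw [rotatedH_eq_bellmanMatrix_add, quadForm_add_left, quadForm_bellmanMatrix, hL, hneg]
  ring

lemma stageCost_rotate (hL : L.IsSymm) (x : Fin n → ℝ) (u : Fin m → ℝ) :
    (p.rotate L).stageCost x u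
      = p.stageCost x u + quadForm L x - quadForm L (p.A *ᵥ x + p.B *ᵥ u) := by
  rw [← quadForm_rotatedH, ← H_rotate hL]
  rfl

lemma state_rotate (x₀ : Fin n → ℝ) (u : ℕ → Fin m → ℝ) :
    (p.rotate L).state x₀ u = p.state x₀ u := by
  funext k
  induction k with
  | zero => rfl
  | succ k ih => rw [state_succ, state_succ, ih]; rfl

lemma finiteCost_rotate (hL : L.IsSymm) (x₀ : Fin n → ℝ) (u : ℕ → Fin m → ℝ) :
    (p.rotate L).finiteCost x₀ u = fun N => p.finiteCost x₀ u N + quadForm L x₀ := by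
  have htelescope (N : ℕ) : ∑ k ∈ Finset.range N,
      (quadForm L (p.state x₀ u k) - quadForm L (p.state x₀ u (k + 1)))
      = quadForm L x₀ - quadForm L (p.state x₀ u N) :=
    Finset.sum_range_sub' (fun k => quadForm L (p.state x₀ u k)) N
  funext N
  simp only [finiteCost_eq, state_rotate, stageCost_rotate hL, ← state_succ, add_sub_assoc,
    Finset.sum_add_distrib, htelescope]
  rw [show (p.rotate L).Pf = p.Pf + L from rfl, quadForm_add_left]
  ring

lemma HasCostDichotomy.of_rotate (hL : L.IsSymm) (h : (p.rotate L).HasCostDichotomy) :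
    p.HasCostDichotomy := by
  intro x₀ u
  have hcost : p.finiteCost x₀ u = fun N => (p.rotate L).finiteCost x₀ u N - quadForm L x₀ := by
    simp [finiteCost_rotate hL]
  have hdich := h x₀ u
  rw [state_rotate] at hdich
  rw [hcost]
  exact hdich.imp (tendsto_atTop_add_const_right _ _)
    fun ⟨hx, c, hc⟩ => ⟨hx, _, hc.sub_const _⟩

lemma inputWeight_rotate : (p.rotate L).inputWeight (P + L) = p.inputWeight P := by
  simp only [inputWeight, rotate, Matrix.mul_add, Matrix.add_mul]
  abel

lemma gain_rotate : (p.rotate L).gain (P + L) = p.gain P := by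
  have hcross : (p.rotate L).S + p.Bᵀ * (P + L) * p.A = p.S + p.Bᵀ * P * p.A := by
    simp only [rotate, Matrix.mul_add, Matrix.add_mul]
    abel
  exact congrArg₂ (fun G C => G⁻¹ * C) inputWeight_rotate hcross

lemma riccati_rotate (hL : L.IsSymm) : (p.rotate L).riccati (P + L) = p.riccati P + L := by
  simp only [riccati, gain_rotate]
  simp only [rotate, transpose_sub, transpose_mul, transpose_transpose, hL.eq, Matrix.mul_add,
    Matrix.add_mul, Matrix.sub_mul, Matrix.mul_assoc]
  abel

lemma isStabilizingSolution_rotate_iff (hL : L.IsSymm) :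
    (p.rotate L).IsStabilizingSolution (P + L) ↔ p.IsStabilizingSolution P := by
  have hsymm : (P + L).IsSymm ↔ P.IsSymm :=
    ⟨fun h => by simpa using h.sub hL, fun h => h.add hL⟩
  have hDARE : (p.rotate L).IsDARESolution (P + L) ↔ p.IsDARESolution P := by
    rw [isDARESolution_iff, isDARESolution_iff, hsymm, inputWeight_rotate, riccati_rotate hL,
      add_left_inj]
  have hloop : (p.rotate L).A - (p.rotate L).B * (p.rotate L).gain (P + L)
      = p.A - p.B * p.gain P := by
    rw [gain_rotate]
    rfl
  exact ⟨fun h => ⟨hDARE.mp h.isSolution, hloop ▸ h.schur⟩,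
    fun h => ⟨hDARE.mpr h.isSolution, hloop.symm ▸ h.schur⟩⟩

lemma isSymm_rotatedH (hH : p.H.IsSymm) (hL : L.IsSymm) : (p.rotatedH L).IsSymm := by
  rw [rotatedH_eq_bellmanMatrix_add]
  refine (hH.add ?_).add (.fromBlocks hL (transpose_zero) isSymm_zero)
  simp only [IsSymm, transpose_mul, transpose_transpose, transpose_neg, hL.eq, Matrix.mul_assoc]

lemma QuadStrictPreDissipative.exists_posDef_rotatedH (hdiss : p.QuadStrictPreDissipative)
    (hH : p.H.PosSemidef) (hPf : p.Pf.PosDef) :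
    ∃ L : Matrix (Fin n) (Fin n) ℝ, L.IsSymm ∧ (p.rotatedH L).PosDef ∧ (p.Pf + L).PosSemidef := by
  obtain ⟨Λ, ε, hε, hdiss⟩ := hdiss
  obtain ⟨L, hL, hLΛ⟩ := exists_isSymm_quadForm_eq Λ
  obtain ⟨c, hc, hc0, hc1⟩ := (((eventually_posDef_add_smul hPf hL).filter_mono
    nhdsWithin_le_nhds).and (Ioo_mem_nhdsGT (zero_lt_one (α := ℝ)))).exists
  refine ⟨c • L, hL.smul c, ?_, hc.posSemidef⟩
  refine posDef_iff_isSymm_and_quadForm_pos.mpr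
    ⟨isSymm_rotatedH (isHermitian_iff_isSymm.mp hH.isHermitian) (hL.smul c), fun z hz => ?_⟩
  obtain ⟨x, u, rfl⟩ : ∃ x u, z = Sum.elim x u := ⟨_, _, (Sum.elim_comp_inl_inr z).symm⟩
  have hpos : 0 < x ⬝ᵥ x + u ⬝ᵥ u := by
    rw [← sumElim_dotProduct_sumElim]
    simpa only [star_trivial] using dotProduct_star_self_pos_iff.mpr hz
  have hΛ : ε * (x ⬝ᵥ x + u ⬝ᵥ u) ≤ quadForm (p.rotatedH Λ) (Sum.elim x u) := hdiss x u
  have hconvex : quadForm (p.rotatedH (c • L)) (Sum.elim x u)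
      = (1 - c) * p.stageCost x u + c * quadForm (p.rotatedH Λ) (Sum.elim x u) := by
    simp only [quadForm_rotatedH, quadForm_smul_left, hLΛ]
    ring
  rw [hconvex]
  exact add_pos_of_nonneg_of_pos (mul_nonneg (sub_nonneg.mpr hc1.le) (stageCost_nonneg hH x u))
    (mul_pos hc0 ((mul_pos hε hpos).trans_le hΛ))

end Rotation

end LQProblem

theorem mainTheorem4_general (n m : ℕ) (p : LQProblem n m) (L : Matrix (Fin n) (Fin n) ℝ)
    (hL : L.IsSymm) (hH : (p.rotatedH L).PosDef) (hPf : (p.Pf + L).PosSemidef)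
    (hstab : IsStabilizable p.A p.B) :
    (∃ P : Matrix (Fin n) (Fin n) ℝ, p.IsStabilizingSolution P) ∧
    (∀ (x₀ : Fin n → ℝ) (u : ℕ → Fin m → ℝ), ∃ J : EReal, p.HasInfiniteCost x₀ u J) ∧
    ∀ P : Matrix (Fin n) (Fin n) ℝ, p.IsStabilizingSolution P →
      p.IsValueFunction (fun x => x ⬝ᵥ (P *ᵥ x)) ∧
      p.IsOptimalFeedback (fun x => -(p.gain P *ᵥ x)) := by
  rw [← LQProblem.H_rotate hL] at hH
  have hdich : p.HasCostDichotomy := (LQProblem.hasCostDichotomy_of_posDef hH hPf).of_rotate hL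
  refine ⟨?_, hdich.exists_hasInfiniteCost, fun P hP => ?_⟩
  · obtain ⟨P, hP⟩ := LQProblem.exists_isStabilizingSolution hH hstab
    exact ⟨P - L, (LQProblem.isStabilizingSolution_rotate_iff hL).mp (by rwa [sub_add_cancel])⟩
  · have hProt := (LQProblem.isStabilizingSolution_rotate_iff hL).mpr hP
    have hG : (p.inputWeight P).PosDef := by
      rw [← LQProblem.inputWeight_rotate (L := L)]
      exact LQProblem.posDef_inputWeight (LQProblem.posDef_R hH) (hProt.posSemidef hH.posSemidef)
    exact ⟨hP.isValueFunction hG hdich, hP.isOptimalFeedback hG hdich⟩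

theorem mainTheorem4 (n m : ℕ) (p : LQProblem n m)
    (hH : p.H.PosSemidef) (hPf : p.Pf.PosDef)
    (hstab : IsStabilizable p.A p.B) (hdiss : p.QuadStrictPreDissipative) :
    (∃ P : Matrix (Fin n) (Fin n) ℝ, p.IsStabilizingSolution P) ∧
    (∀ (x₀ : Fin n → ℝ) (u : ℕ → Fin m → ℝ), ∃ J : EReal, p.HasInfiniteCost x₀ u J) ∧
    ∀ P : Matrix (Fin n) (Fin n) ℝ, p.IsStabilizingSolution P →
      p.IsValueFunction (fun x => x ⬝ᵥ (P *ᵥ x)) ∧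
      p.IsOptimalFeedback (fun x => -(p.gain P *ᵥ x)) := by
  obtain ⟨L, hL, hHL, hPfL⟩ := hdiss.exists_posDef_rotatedH hH hPf
  exact mainTheorem4_general n m p L hL hHL hPfL hstab
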